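/- Let $C(S,K)$ ($S>0$, $K\ge 0$) be a Call pricing function: for every $S>0$ the map $K\mapsto C(S,K)$ is convex on $[0,\infty)$ and satisfies $(S-K)_+\le C(S,K)\le S$. Write $\partial_KC(S,K)$ for its right derivative in the strike, so that $-\partial_KC(S,K)=1-P(S_T\le K)$ when $C(S,K)=E[(S_T-K)_+]$. Fix $K>0$ and assume that $S\mapsto C(S,K)$ is injective on $(0,\infty)$, with inverse $X\mapsto C^{-1}(X,K)$. Assume that there is a function $f$ such that $$f\Bigl(\tfrac{C(S,K)}{-\partial_KC(S,K)}\Bigr)=C(S,K)\qquad\text{for all } S>0 \text{ with } \partial_KC(S,K)<0 .$$ Define the relative Call on Call price $\hat C_K(X,M)=C(C^{-1}(X,K),K+M)$ and the lifted Call on Call price $$\hat C_K^{**}(X^{**},M)=\frac{X^{**}}{f(X^{**})}\,\hat C_K(f(X^{**}),M).$$ Let $S>0$ with $\partial_KC(S,K)<0$ and let $X^{**}=C(S,K)/(-\partial_KC(S,K))$, so that $f(X^{**})=C(S,K)$ and $C^{-1}(f(X^{**}),K)=S$. For $S,L>0$ let $\mathrm{BS}(S,L,v)=S\Phi(d_1)-L\Phi(d_2)$,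 $d_{1,2}=-\frac{\log(L/S)}{v}\pm\frac v2$ for $v>0$, where $\Phi$ is the standard normal distribution function, and $\mathrm{BS}(S,L,0)=(S-L)_+$. The implied total volatility of a Call price $p$ with underlier $S$ and strike $L$ is the $v\in[0,\infty)$ with $\mathrm{BS}(S,L,v)=p$. Let $\hat v_K^{**}(X^{**},M)$ be the implied total volatility of $\hat C_K^{**}(X^{**},M)$ with underlier $X^{**}$ and strike $M$, and let $v(S,L)$ be that of $C(S,L)$. Write $g\sim h$ for $g-h=o(h)$ (that is, $g/h\to1$ where $h\neq0$). Then for every $M>0$ the implied total volatilities $\hat v_K^{**}(X^{**},M)$ and $v(C^{-1}(f(X^{**}),K),K+M)$ exist and are unique, and: 1. The function $M\mapsto\hat C_K^{**}(X^{**},M)$ has right derivative $-1$ at $M=0$. 2. If $C(S,\cdot)$ is twice differentiable at $K$ with $\partial_K^2C(S,K)>0$, then $\hat v_K^{**}(X^{**},M)\sim(2-\sqrt2)\sqrt{-\log\frac{M}{X^{**}}}$ as $M\to0^+$. 3. $\hat v_K^{**}(X^{**},M)\sim v\bigl(C^{-1}(f(X^{**}),K),K+M\bigr)$ as $M\to\infty$.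 Moreover, for every $\ell\in[0,\infty]$, $\hat v_K^{**}(X^{**},M)\to\ell$ as $M\to\infty$ if and only if $v\bigl(C^{-1}(f(X^{**}),K),K+M\bigr)\to\ell$. -/

import Mathlib

open Filter Topology Asymptotics

noncomputable section

/-- A Call pricing function `C S K` (underlier `S > 0`, strike `K ≥ 0`): convex in the strike and
between the intrinsic value and the underlier.  (It is then non-increasing in the strike.) -/
structure IsCallPricing (C : ℝ → ℝ → ℝ) : Prop where
  convex : ∀ S, 0 < S → ConvexOn ℝ (Set.Ici 0) (C S)
  intrinsic_le : ∀ S, 0 < S → ∀ K, 0 ≤ K → max (S - K) 0 ≤ C S K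
  le_underlier : ∀ S, 0 < S → ∀ K, 0 ≤ K → C S K ≤ S

/-- The strike derivative `∂_K C(S, K)`, taken from the right.  By convexity in the strike it
exists for every `K > 0`, and it is the usual derivative wherever the latter exists.
When `C(S, K) = E[(S_T - K)₊]`, it equals `-P(S_T > K) = -(1 - P(S_T ≤ K))`. -/
def strikeDeriv (C : ℝ → ℝ → ℝ) (S K : ℝ) : ℝ :=
  derivWithin (C S) (Set.Ioi K) K

/-- `C⁻¹(X, K)`: the underlier `S > 0` with `C(S, K) = X`. -/
def invPrice (C : ℝ → ℝ → ℝ) (X K : ℝ) : ℝ :=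
  Function.invFunOn (fun S => C S K) (Set.Ioi 0) X

/-- The relative Call on Call price `Ĉ_K(X, M) = C(C⁻¹(X, K), K + M)`. -/
def callOnCall (C : ℝ → ℝ → ℝ) (K X M : ℝ) : ℝ :=
  C (invPrice C X K) (K + M)

/-- The underlier `X** = C(S, K) / (1 - P(S_T ≤ K)) = C(S, K) / (-∂_K C(S, K))` of the lifted
Call on Call, as a function of the original underlier `S`. -/
def liftedUnderlier (C : ℝ → ℝ → ℝ) (K S : ℝ) : ℝ :=
  C S K / (-strikeDeriv C S K)

/-- The lifted Call on Call price `Ĉ**_K(X**, M) = X** / f(X**) * Ĉ_K(f(X**), M)`, where `f` is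
the function that recovers `X = C(S, K)` from `X**`. -/
def liftedCallOnCall (C : ℝ → ℝ → ℝ) (f : ℝ → ℝ) (K Xss M : ℝ) : ℝ :=
  Xss / f Xss * callOnCall C K (f Xss) M

/-- The standard normal cumulative distribution function `Φ`. -/
def normalCDF (x : ℝ) : ℝ :=
  ProbabilityTheory.cdf (ProbabilityTheory.gaussianReal 0 1) x

/-- `d₁(S, K, v)`. -/
def bsD1 (S K v : ℝ) : ℝ := -(Real.log (K / S) / v) + v / 2

/-- `d₂(S, K, v)`. -/
def bsD2 (S K v : ℝ) : ℝ := -(Real.log (K / S) / v) - v / 2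

/-- The Black-Scholes Call price with total implied volatility `v`; at `v = 0` it is the limit
as `v → 0+`, that is, the intrinsic value. -/
def blackScholes (S K v : ℝ) : ℝ :=
  if v = 0 then max (S - K) 0
  else S * normalCDF (bsD1 S K v) - K * normalCDF (bsD2 S K v)

/-- The implied total volatility of a Call price `p` with underlier `S` and strike `K`:
the `v ≥ 0` with `BS(S, K, v) = p`. -/
def impliedVol (S K p : ℝ) : ℝ :=
  Function.invFunOn (blackScholes S K) (Set.Ici 0) p

/-- `v(S, L)`: the implied total volatility of the Call `C(S, L)`. -/
def underlyingVol (C : ℝ → ℝ → ℝ) (S L : ℝ) : ℝ :=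
  impliedVol S L (C S L)

/-- `v̂**_K(X**, M)`: the implied total volatility of the lifted Call on Call. -/
def liftedVol (C : ℝ → ℝ → ℝ) (f : ℝ → ℝ) (K Xss M : ℝ) : ℝ :=
  impliedVol Xss M (liftedCallOnCall C f K Xss M)

end

/-! Injectivity identifies `C⁻¹(f(X**), K)` with `S`, so with `m = -∂_K C(S, K)` the lifted price is
`C(S, K + M) / m`. This is `X**` at `M = 0` and has slope `-1` there. Convexity and strict decrease
place it in `[X** - M, X**)`, where the implied volatility exists and is unique. Everything else
concerns `normBS`, the price per unit of underlier at log-moneyness `k`.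

Large strikes: the two normalised prices differ by a constant factor, and the log-moneynesses by a
bounded shift. Scaling the volatility by `q > 1` raises the first quantile by at least a multiple of
`√k` (`quantileOne_shift`), so the vega gains any prescribed factor. Integrating from volatility
zero absorbs both discrepancies (`mul_normBS_le`, `isEquivalent_of_normBS`), with no assumption on
how the volatility itself behaves.

Small strikes: put-call parity turns the price into a normalised one at `k = -log (M / X**)`, given
by the second-order Taylor remainder of `C S` at `K`, hence of order `exp (-k)`. At volatility `c
√k` the exponential rate of `normBS` is `(1/c - c/2)² / 2`, which is `1` at `c = 2 - √2`
(`isEquivalent_sqrt_of_normBS`). -/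

/-! ### The normal distribution: derivative, symmetry and tails. -/

/-- The standard normal density. -/
noncomputable def normalPDF (x : ℝ) : ℝ := (√(2 * Real.pi))⁻¹ * Real.exp (-(x ^ 2 / 2))

lemma normalPDF_pos (x : ℝ) : 0 < normalPDF x := by
  unfold normalPDF; positivity

lemma gaussianPDFReal_eq_normalPDF :
    ProbabilityTheory.gaussianPDFReal 0 1 = normalPDF := by
  ext x
  simp [ProbabilityTheory.gaussianPDFReal_def, normalPDF, neg_div]

lemma continuous_normalPDF : Continuous normalPDF := by
  unfold normalPDF; fun_prop

lemma integrable_normalPDF : MeasureTheory.Integrable normalPDF :=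
  gaussianPDFReal_eq_normalPDF ▸ ProbabilityTheory.integrable_gaussianPDFReal 0 1

lemma normalCDF_eq_measureReal (x : ℝ) :
    normalCDF x = (ProbabilityTheory.gaussianReal 0 1).real (Set.Iic x) :=
  ProbabilityTheory.cdf_eq_real _ x

lemma normalCDF_eq_integral (x : ℝ) : normalCDF x = ∫ y in Set.Iic x, normalPDF y := by
  rw [normalCDF_eq_measureReal, MeasureTheory.measureReal_def,
    ProbabilityTheory.gaussianReal_apply_eq_integral _ one_ne_zero, gaussianPDFReal_eq_normalPDF,
    ENNReal.toReal_ofReal]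
  exact MeasureTheory.integral_nonneg fun y => (normalPDF_pos y).le

lemma hasDerivAt_normalCDF (x : ℝ) : HasDerivAt normalCDF (normalPDF x) x := by
  have h : normalCDF = fun y => normalCDF 0 + ∫ t in (0 : ℝ)..y, normalPDF t := by
    ext y
    rw [normalCDF_eq_integral, normalCDF_eq_integral, ← intervalIntegral.integral_Iic_sub_Iic
      integrable_normalPDF.integrableOn integrable_normalPDF.integrableOn]
    ring
  rw [h]
  exact (intervalIntegral.integral_hasDerivAt_right
    (continuous_normalPDF.intervalIntegrable _ _)
    continuous_normalPDF.stronglyMeasurable.stronglyMeasurableAtFilter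
    continuous_normalPDF.continuousAt).const_add _

lemma continuous_normalCDF : Continuous normalCDF :=
  continuous_iff_continuousAt.2 fun x => (hasDerivAt_normalCDF x).continuousAt

lemma normalCDF_nonneg (x : ℝ) : 0 ≤ normalCDF x := ProbabilityTheory.cdf_nonneg _ x

lemma normalCDF_neg (x : ℝ) : normalCDF (-x) = 1 - normalCDF x := by
  have h : ∫ y in Set.Iic (-x), normalPDF y = ∫ y in Set.Ioi x, normalPDF y := by
    rw [← integral_comp_neg_Ioi]
    simp [normalPDF]
  have h1 : (∫ y, normalPDF y) = 1 :=
    gaussianPDFReal_eq_normalPDF ▸ ProbabilityTheory.integral_gaussianPDFReal_eq_one 0 one_ne_zero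
  have h2 := MeasureTheory.integral_add_compl (measurableSet_Iic (a := x)) integrable_normalPDF
  rw [Set.compl_Iic, h1] at h2
  rw [normalCDF_eq_integral, normalCDF_eq_integral, h]
  linarith

/-- Chernoff's bound with the optimal parameter, which is `x` itself. -/
lemma normalCDF_le_exp {x : ℝ} (hx : x ≤ 0) : normalCDF x ≤ Real.exp (-(x ^ 2 / 2)) := by
  have h := ProbabilityTheory.measure_le_le_exp_mul_mgf (μ := ProbabilityTheory.gaussianReal 0 1)
    (X := id) x hx (ProbabilityTheory.integrable_exp_mul_gaussianReal x)
  rw [ProbabilityTheory.mgf_id_gaussianReal, ← Real.exp_add] at h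
  rw [normalCDF_eq_measureReal]
  refine h.trans (le_of_eq ?_)
  congr 1
  simp only [NNReal.coe_one]
  ring

lemma one_sub_exp_le_normalCDF {x : ℝ} (hx : 0 ≤ x) :
    1 - Real.exp (-(x ^ 2 / 2)) ≤ normalCDF x := by
  have h1 := normalCDF_le_exp (neg_nonpos.2 hx)
  rw [normalCDF_neg, neg_sq] at h1
  linarith

/-! ### Normalised Black-Scholes prices and implied volatility. -/

/-- The first Black-Scholes quantile at log-moneyness `k` and total volatility `v`. -/
noncomputable def quantileOne (k v : ℝ) : ℝ := -(k / v) + v / 2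

/-- The second Black-Scholes quantile at log-moneyness `k` and total volatility `v`. -/
noncomputable def quantileTwo (k v : ℝ) : ℝ := -(k / v) - v / 2

/-- The Black-Scholes Call price per unit of underlier, at log-moneyness `k`. -/
noncomputable def normBS (k v : ℝ) : ℝ :=
  if v = 0 then max (1 - Real.exp k) 0
  else normalCDF (quantileOne k v) - Real.exp k * normalCDF (quantileTwo k v)

lemma normBS_zero (k : ℝ) : normBS k 0 = max (1 - Real.exp k) 0 := if_pos rfl

lemma normBS_zero_of_nonneg {k : ℝ} (hk : 0 ≤ k) : normBS k 0 = 0 := by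
  rw [normBS_zero, max_eq_right]
  linarith [Real.one_le_exp hk]

lemma normBS_of_ne_zero (k : ℝ) {v : ℝ} (hv : v ≠ 0) :
    normBS k v = normalCDF (quantileOne k v) - Real.exp k * normalCDF (quantileTwo k v) :=
  if_neg hv

lemma blackScholes_eq {S L : ℝ} (hS : 0 < S) (hL : 0 < L) (v : ℝ) :
    blackScholes S L v = S * normBS (Real.log (L / S)) v := by
  have hexp : Real.exp (Real.log (L / S)) = L / S := Real.exp_log (div_pos hL hS)
  by_cases hv : v = 0
  · rw [blackScholes, if_pos hv, normBS, if_pos hv, hexp, mul_max_of_nonneg _ _ hS.le]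
    rw [mul_zero]
    congr 1
    field_simp
  · rw [blackScholes, if_neg hv, normBS_of_ne_zero _ hv, hexp]
    simp only [bsD1, bsD2, quantileOne, quantileTwo]
    field_simp

/-- Put-call parity combined with put-call symmetry: changing the sign of `k` swaps the two
quantiles up to sign. -/
lemma normBS_neg (k v : ℝ) :
    normBS (-k) v = 1 - Real.exp (-k) + Real.exp (-k) * normBS k v := by
  have hexp : Real.exp (-k) * Real.exp k = 1 := by rw [← Real.exp_add]; simp
  by_cases hv : v = 0
  · rw [hv, normBS_zero, normBS_zero, mul_max_of_nonneg _ _ (Real.exp_pos _).le, mul_sub, hexp,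
      mul_zero, mul_one, max_comm, ← max_add_add_left]
    congr 1 <;> ring
  · rw [normBS_of_ne_zero _ hv, normBS_of_ne_zero _ hv]
    have h1 : quantileOne (-k) v = -quantileTwo k v := by
      simp only [quantileOne, quantileTwo]; ring
    have h2 : quantileTwo (-k) v = -quantileOne k v := by
      simp only [quantileOne, quantileTwo]; ring
    rw [h1, h2, normalCDF_neg, normalCDF_neg]
    linear_combination normalCDF (quantileTwo k v) * hexp

/-- The quantiles have difference `v` and sum `-2k/v`, so their squares differ by `2k`. -/
lemma exp_mul_exp_quantileTwo (k : ℝ) {v : ℝ} (hv : v ≠ 0) :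
    Real.exp k * Real.exp (-(quantileTwo k v ^ 2 / 2)) =
      Real.exp (-(quantileOne k v ^ 2 / 2)) := by
  rw [← Real.exp_add]
  congr 1
  simp only [quantileOne, quantileTwo]
  field_simp
  ring

lemma exp_mul_normalPDF_quantileTwo (k : ℝ) {v : ℝ} (hv : v ≠ 0) :
    Real.exp k * normalPDF (quantileTwo k v) = normalPDF (quantileOne k v) := by
  rw [normalPDF, mul_left_comm, exp_mul_exp_quantileTwo k hv, normalPDF]

/-- The vega of the normalised Black-Scholes price. -/
lemma hasDerivAt_normBS (k : ℝ) {v : ℝ} (hv : v ≠ 0) :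
    HasDerivAt (normBS k) (normalPDF (quantileOne k v)) v := by
  have hk : HasDerivAt (fun u : ℝ => -(k / u)) (k / v ^ 2) v := by
    refine (((hasDerivAt_inv hv).const_mul k).neg).congr_deriv ?_
    field_simp
  have h1 : HasDerivAt (quantileOne k) (k / v ^ 2 + 1 / 2) v :=
    hk.add ((hasDerivAt_id v).div_const 2)
  have h2 : HasDerivAt (quantileTwo k) (k / v ^ 2 - 1 / 2) v :=
    hk.sub ((hasDerivAt_id v).div_const 2)
  have h3 := ((hasDerivAt_normalCDF (quantileOne k v)).comp v h1).sub
    (((hasDerivAt_normalCDF (quantileTwo k v)).comp v h2).const_mul (Real.exp k))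
  have h4 : normBS k =ᶠ[𝓝 v] (normalCDF ∘ quantileOne k) -
      fun y => Real.exp k * (normalCDF ∘ quantileTwo k) y := by
    filter_upwards [isOpen_ne.mem_nhds hv] with u hu
    exact normBS_of_ne_zero k hu
  refine (h3.congr_of_eventuallyEq h4).congr_deriv ?_
  linear_combination (1 / 2 - k / v ^ 2) * exp_mul_normalPDF_quantileTwo k hv

lemma normBS_le_exp {k v : ℝ} (hv : v ≠ 0) (h : quantileOne k v ≤ 0) :
    normBS k v ≤ Real.exp (-(quantileOne k v ^ 2 / 2)) := by
  rw [normBS_of_ne_zero k hv]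
  have := mul_nonneg (Real.exp_pos k).le (normalCDF_nonneg (quantileTwo k v))
  linarith [normalCDF_le_exp h]

lemma one_sub_two_mul_exp_le_normBS {k v : ℝ} (hv : v ≠ 0) (h1 : 0 ≤ quantileOne k v)
    (h2 : quantileTwo k v ≤ 0) :
    1 - 2 * Real.exp (-(quantileOne k v ^ 2 / 2)) ≤ normBS k v := by
  rw [normBS_of_ne_zero k hv]
  have h3 := mul_le_mul_of_nonneg_left (normalCDF_le_exp h2) (Real.exp_pos k).le
  rw [exp_mul_exp_quantileTwo k hv] at h3
  linarith [one_sub_exp_le_normalCDF h1]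

lemma tendsto_normBS_atTop (k : ℝ) : Tendsto (normBS k) atTop (𝓝 1) := by
  have hk : Tendsto (fun v : ℝ => k / v) atTop (𝓝 0) := tendsto_const_nhds.div_atTop tendsto_id
  have hv : Tendsto (fun v : ℝ => v / 2) atTop atTop := tendsto_id.atTop_div_const two_pos
  have h1 : Tendsto (quantileOne k) atTop atTop := hk.neg.add_atTop hv
  have h2 : Tendsto (quantileTwo k) atTop atBot :=
    hk.neg.add_atBot (tendsto_neg_atTop_atBot.comp hv)
  have h6 : Tendsto (fun v => Real.exp k * normalCDF (quantileTwo k v)) atTop (𝓝 0) := by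
    have h := ((ProbabilityTheory.tendsto_cdf_atBot
      (ProbabilityTheory.gaussianReal 0 1)).comp h2).const_mul (Real.exp k)
    rwa [mul_zero] at h
  have h7 := ((ProbabilityTheory.tendsto_cdf_atTop
    (ProbabilityTheory.gaussianReal 0 1)).comp h1).sub h6
  rw [sub_zero] at h7
  refine h7.congr' ?_
  filter_upwards [eventually_ne_atTop 0] with v hv
  exact (normBS_of_ne_zero k hv).symm

lemma continuousOn_normBS_of_nonneg {k : ℝ} (hk : 0 ≤ k) :
    ContinuousOn (normBS k) (Set.Ici 0) := by
  intro v hv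
  rcases (show (0 : ℝ) ≤ v from hv).eq_or_lt' with rfl | hv
  swap
  · exact (hasDerivAt_normBS k hv.ne').continuousAt.continuousWithinAt
  rw [← continuousWithinAt_Ioi_iff_Ici, ContinuousWithinAt, normBS_zero_of_nonneg hk]
  -- As `v → 0+` both quantiles tend to `0` at the money, but to `-∞` when `k > 0`.
  rcases hk.eq_or_lt with rfl | hk
  · have h : Continuous fun v : ℝ => normalCDF (v / 2) - normalCDF (-(v / 2)) :=
      (continuous_normalCDF.comp (by fun_prop)).sub (continuous_normalCDF.comp (by fun_prop))
    have h0 := (h.tendsto 0).mono_left (nhdsWithin_le_nhds (s := Set.Ioi 0))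
    simp only [zero_div, neg_zero, sub_self] at h0
    refine h0.congr' ?_
    filter_upwards [self_mem_nhdsWithin] with v hv
    rw [normBS_of_ne_zero _ (ne_of_gt hv)]
    simp [quantileOne, quantileTwo]
  · have hd : Tendsto (quantileOne k) (𝓝[>] 0) atBot := by
      have h1 : Tendsto (fun v : ℝ => -(k * v⁻¹)) (𝓝[>] 0) atBot :=
        tendsto_neg_atTop_atBot.comp (tendsto_inv_nhdsGT_zero.const_mul_atTop hk)
      have h2 : Tendsto (fun v : ℝ => v / 2) (𝓝[>] 0) (𝓝 (0 / 2)) :=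
        (tendsto_id.div_const 2).mono_left nhdsWithin_le_nhds
      exact h1.atBot_add h2
    have hd' : Tendsto (quantileTwo k) (𝓝[>] 0) atBot := by
      refine tendsto_atBot_mono' _ ?_ hd
      filter_upwards [self_mem_nhdsWithin] with v hv
      simp only [quantileOne, quantileTwo]
      linarith [show (0 : ℝ) < v from hv]
    have h7 := ((ProbabilityTheory.tendsto_cdf_atBot
      (ProbabilityTheory.gaussianReal 0 1)).comp hd).sub
      (((ProbabilityTheory.tendsto_cdf_atBot
      (ProbabilityTheory.gaussianReal 0 1)).comp hd').const_mul (Real.exp k))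
    rw [mul_zero, sub_zero] at h7
    refine h7.congr' ?_
    filter_upwards [self_mem_nhdsWithin] with v hv
    exact (normBS_of_ne_zero k (ne_of_gt hv)).symm

lemma continuousOn_normBS (k : ℝ) : ContinuousOn (normBS k) (Set.Ici 0) := by
  rcases le_total 0 k with hk | hk
  · exact continuousOn_normBS_of_nonneg hk
  · have h : normBS k = fun v => 1 - Real.exp k + Real.exp k * normBS (-k) v := by
      ext v; simpa using normBS_neg (-k) v
    rw [h]
    exact continuousOn_const.add
      (continuousOn_const.mul (continuousOn_normBS_of_nonneg (neg_nonneg.2 hk)))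

lemma strictMonoOn_normBS (k : ℝ) : StrictMonoOn (normBS k) (Set.Ici 0) := by
  refine strictMonoOn_of_deriv_pos (convex_Ici 0) (continuousOn_normBS k) fun v hv => ?_
  rw [interior_Ici] at hv
  rw [(hasDerivAt_normBS k (ne_of_gt hv)).deriv]
  exact normalPDF_pos _

lemma normBS_nonneg (k : ℝ) {v : ℝ} (hv : 0 ≤ v) : 0 ≤ normBS k v := by
  refine le_trans ?_ ((strictMonoOn_normBS k).monotoneOn Set.self_mem_Ici hv hv)
  rw [normBS_zero]
  exact le_max_right _ _

lemma existsUnique_normBS_eq {k p : ℝ} (h0 : max (1 - Real.exp k) 0 ≤ p) (h1 : p < 1) :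
    ∃! v, 0 ≤ v ∧ normBS k v = p := by
  obtain ⟨u, hu, hu0⟩ := (((tendsto_normBS_atTop k).eventually_const_lt h1).and
    (eventually_ge_atTop 0)).exists
  obtain ⟨v, hv, hvp⟩ := intermediate_value_Icc hu0
    ((continuousOn_normBS k).mono Set.Icc_subset_Ici_self) ⟨normBS_zero k ▸ h0, hu.le⟩
  exact ⟨v, ⟨hv.1, hvp⟩, fun w hw =>
    (strictMonoOn_normBS k).injOn hw.1 hv.1 (hw.2.trans hvp.symm)⟩

lemma existsUnique_blackScholes_eq {S L p : ℝ} (hS : 0 < S) (hL : 0 < L) (h0 : 0 ≤ p)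
    (h1 : S - L ≤ p) (h2 : p < S) : ∃! v, 0 ≤ v ∧ blackScholes S L v = p := by
  have h3 : max (1 - Real.exp (Real.log (L / S))) 0 ≤ p / S := by
    rw [Real.exp_log (div_pos hL hS)]
    refine max_le ?_ (div_nonneg h0 hS.le)
    rw [le_div_iff₀ hS]
    field_simp
    exact h1
  simp_rw [blackScholes_eq hS hL, mul_comm S, ← eq_div_iff hS.ne']
  exact existsUnique_normBS_eq h3 ((div_lt_one hS).2 h2)

lemma impliedVol_spec {S L p : ℝ} (h : ∃! v, 0 ≤ v ∧ blackScholes S L v = p) :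
    0 ≤ impliedVol S L p ∧ blackScholes S L (impliedVol S L p) = p :=
  Function.invFunOn_pos h.exists

/-! ### Insensitivity of the volatility to bounded shifts and constant factors. -/

/-- Half of the gain in the `k / u` term pays for `h`; what remains is at least `√k`, up to the
factor `1 - q⁻¹`, by the arithmetic-geometric mean inequality, uniformly in `u`. -/
lemma quantileOne_shift {q k h u : ℝ} (hq : 1 < q) (hk : 0 ≤ k) (hu : 0 < u)
    (hh : |h| ≤ (1 - q⁻¹) * k / 2) :
    quantileOne k u + (1 - q⁻¹) * √k ≤ quantileOne (k + h) (q * u) := by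
  have hq0 : 0 < q := by linarith
  have hη : 0 < 1 - q⁻¹ := sub_pos.2 (inv_lt_one_of_one_lt₀ hq)
  have hs : √k ^ 2 = k := Real.sq_sqrt hk
  have h1 : √k ≤ k / (2 * u) + u / 2 := by
    have : k / (2 * u) + u / 2 - √k = (√k - u) ^ 2 / (2 * u) := by
      field_simp
      linear_combination -hs
    have h2 : 0 ≤ (√k - u) ^ 2 / (2 * u) := by positivity
    linarith
  have h2 : h / (q * u) ≤ (1 - q⁻¹) * k / (2 * u) := by
    have h3 : h ≤ (1 - q⁻¹) * k / 2 := (le_abs_self h).trans hh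
    have h4 : h / (q * u) ≤ (1 - q⁻¹) * k / 2 / (q * u) := by gcongr
    have h5 : (1 - q⁻¹) * k / 2 / (q * u) ≤ (1 - q⁻¹) * k / 2 / u := by
      gcongr
      nlinarith
    calc _ ≤ _ := h4.trans h5
      _ = _ := by field_simp
  have h3 : 1 - q⁻¹ ≤ q - 1 := by
    have : q - 1 - (1 - q⁻¹) = (q - 1) ^ 2 / q := by field_simp
    have h4 : 0 ≤ (q - 1) ^ 2 / q := by positivity
    linarith
  have h4 : quantileOne (k + h) (q * u) =
      quantileOne k u + (1 - q⁻¹) * (k / u) + (q - 1) * (u / 2) - h / (q * u) := by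
    simp only [quantileOne]
    field_simp
    ring
  have h5 : (1 - q⁻¹) * (u / 2) ≤ (q - 1) * (u / 2) := by gcongr
  have h6 := mul_le_mul_of_nonneg_left h1 hη.le
  have h7 : (1 - q⁻¹) * (k / u) = 2 * ((1 - q⁻¹) * (k / (2 * u))) := by field_simp
  have h8 : (1 - q⁻¹) * k / (2 * u) = (1 - q⁻¹) * (k / (2 * u)) := by ring
  rw [h4]
  linarith

lemma quantileOne_mono {k u v : ℝ} (hk : 0 ≤ k) (hu : 0 < u) (huv : u ≤ v) :
    quantileOne k u ≤ quantileOne k v := by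
  have : k / v ≤ k / u := by gcongr
  simp only [quantileOne]
  linarith

lemma quantileTwo_nonpos {k v : ℝ} (hk : 0 ≤ k) (hv : 0 ≤ v) : quantileTwo k v ≤ 0 := by
  have := div_nonneg hk hv
  simp only [quantileTwo]
  linarith

/-- Since `d ≤ d' - D` and `d' ≤ 0`, one has `d² ≥ d'² + D²`. -/
lemma mul_normPDF_le {A D d d' : ℝ} (hD : 0 ≤ D) (hA : A ≤ Real.exp (D ^ 2 / 2))
    (hd : d + D ≤ d') (hd' : d' ≤ 0) : A * normalPDF d ≤ normalPDF d' := by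
  have h1 : D ^ 2 / 2 - d ^ 2 / 2 ≤ -(d' ^ 2 / 2) := by nlinarith
  calc A * normalPDF d ≤ Real.exp (D ^ 2 / 2) * normalPDF d := by
        gcongr; exact (normalPDF_pos d).le
    _ = (√(2 * Real.pi))⁻¹ * Real.exp (D ^ 2 / 2 - d ^ 2 / 2) := by
        rw [normalPDF, sub_eq_add_neg, Real.exp_add]; ring
    _ ≤ normalPDF d' := by
        rw [normalPDF]; gcongr

/-- As long as the second quantity stays an attainable price, a small relative increase of the
volatility multiplies a far out of the money price by any prescribed factor. -/
lemma mul_normBS_le {q A D k h v : ℝ} (hq : 1 < q) (hD : 0 ≤ D)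
    (hAD : A ≤ Real.exp (D ^ 2 / 2)) (hk : 0 < k) (hkh : 0 < k + h)
    (hh : |h| ≤ (1 - q⁻¹) * k / 2) (h1 : D ≤ (1 - q⁻¹) * √k) (h2 : D ≤ (1 - q⁻¹) * √(k + h))
    (hv : 0 ≤ v) (hp : A * normBS k v ≤ 1 - 2 * Real.exp (-(D ^ 2 / 2))) :
    A * normBS k v ≤ normBS (k + h) (q ^ 2 * v) := by
  have hq0 : 0 < q := by linarith
  have hη : 0 < 1 - q⁻¹ := sub_pos.2 (inv_lt_one_of_one_lt₀ hq)
  rcases hv.eq_or_lt' with rfl | hv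
  · rw [mul_zero, normBS_zero_of_nonneg hk.le, normBS_zero_of_nonneg hkh.le, mul_zero]
  rcases le_total (quantileOne (k + h) (q * v)) 0 with hneg | hpos
  -- The difference vanishes at `u = 0`, and comparing vegas makes it monotone while the shifted
  -- quantile is nonpositive.
  · have hmono : MonotoneOn (fun u => normBS (k + h) (q * u) - A * normBS k u)
        (Set.Icc 0 v) := by
      refine monotoneOn_of_hasDerivWithinAt_nonneg (convex_Icc 0 v)
        (f' := fun u => normalPDF (quantileOne (k + h) (q * u)) * q -
          A * normalPDF (quantileOne k u)) ?_ ?_ ?_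
      · refine ((continuousOn_normBS _).comp (by fun_prop) ?_).sub
          (continuousOn_const.mul ((continuousOn_normBS k).mono Set.Icc_subset_Ici_self))
        intro u hu
        exact mul_nonneg hq0.le hu.1
      · intro u hu
        rw [interior_Icc] at hu
        have h3 : HasDerivAt (fun u => q * u) q u := by
          simpa using (hasDerivAt_id u).const_mul q
        exact (((hasDerivAt_normBS (k + h) (mul_pos hq0 hu.1).ne').comp u h3).sub
          ((hasDerivAt_normBS k hu.1.ne').const_mul A)).hasDerivWithinAt
      · intro u hu
        rw [interior_Icc] at hu
        have h3 := quantileOne_shift hq hk.le hu.1 hh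
        have h4 : quantileOne (k + h) (q * u) ≤ 0 := by
          refine (quantileOne_mono hkh.le (mul_pos hq0 hu.1) ?_).trans hneg
          have := hu.2.le
          gcongr
        have h5 := mul_normPDF_le hD hAD (by linarith : quantileOne k u + D ≤ _) h4
        have h6 := normalPDF_pos (quantileOne (k + h) (q * u))
        nlinarith
    have h3 := hmono (Set.left_mem_Icc.2 hv.le) (Set.right_mem_Icc.2 hv.le) hv.le
    simp only [mul_zero, normBS_zero_of_nonneg hk.le, normBS_zero_of_nonneg hkh.le,
      sub_zero] at h3
    have h4 : normBS (k + h) (q * v) ≤ normBS (k + h) (q ^ 2 * v) := by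
      refine (strictMonoOn_normBS _).monotoneOn (mul_nonneg hq0.le hv.le)
        (mul_nonneg (sq_nonneg q) hv.le) ?_
      gcongr
      nlinarith
    linarith
  -- Past the sign change, the second factor `q` lifts the quantile above `D`, so the price exceeds
  -- the ceiling in `hp`.
  · have h3 := quantileOne_shift (h := 0) hq hkh.le (mul_pos hq0 hv)
      (by rw [abs_zero]; positivity)
    rw [add_zero, ← mul_assoc, ← sq] at h3
    have h4 : D ≤ quantileOne (k + h) (q ^ 2 * v) := by linarith
    have hv' : 0 < q ^ 2 * v := by positivity
    refine hp.trans (le_trans ?_ (one_sub_two_mul_exp_le_normBS hv'.ne' (hD.trans h4)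
      (quantileTwo_nonpos hkh.le hv'.le)))
    gcongr

lemma eventually_mul_normBS_le {q A δ : ℝ} (H : ℝ) (hq : 1 < q) (hδ : 0 < δ) :
    ∀ᶠ k in atTop, ∀ h, |h| ≤ H → 0 < k + h ∧ ∀ v, 0 ≤ v → A * normBS k v ≤ 1 - δ →
      A * normBS k v ≤ normBS (k + h) (q ^ 2 * v) := by
  have hη : 0 < 1 - q⁻¹ := sub_pos.2 (inv_lt_one_of_one_lt₀ hq)
  have hsq : Tendsto (fun D : ℝ => D ^ 2 / 2) atTop atTop :=
    (tendsto_pow_atTop two_ne_zero).atTop_div_const two_pos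
  -- `D` is large enough both to absorb `A` and to make `2 exp (-D²/2) ≤ δ`.
  obtain ⟨D, ⟨hD, hAD⟩, hDδ⟩ := (((eventually_ge_atTop 0).and
    ((Real.tendsto_exp_atTop.comp hsq).eventually_ge_atTop A)).and
    (((Real.tendsto_exp_neg_atTop_nhds_zero.comp hsq).eventually_le_const
      (half_pos hδ)))).exists
  filter_upwards [eventually_gt_atTop 0, eventually_ge_atTop (2 * H / (1 - q⁻¹)),
    eventually_ge_atTop (H + 1), eventually_ge_atTop ((D / (1 - q⁻¹)) ^ 2),
    eventually_ge_atTop ((D / (1 - q⁻¹)) ^ 2 + H)] with k hk h1 h2 h3 h4 h hh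
  have h5 := neg_le_of_abs_le hh
  have h6 : ∀ x, (D / (1 - q⁻¹)) ^ 2 ≤ x → D ≤ (1 - q⁻¹) * √x := fun x hx => by
    rw [mul_comm, ← div_le_iff₀ hη]
    exact Real.le_sqrt_of_sq_le hx
  have hkh : 0 < k + h := by linarith
  refine ⟨hkh, fun v hv hp => mul_normBS_le hq hD hAD hk hkh ?_ (h6 _ h3)
    (h6 _ (by linarith)) hv (hp.trans ?_)⟩
  · rw [div_le_iff₀ hη] at h1
    linarith
  · simp only [Function.comp_apply] at hDδ
    linarith

/-- Far out of the money, implied volatilities are insensitive to bounded shifts of the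
log-moneyness and to constant factors in front of the price. -/
lemma isEquivalent_of_normBS {ι : Type*} {l : Filter ι} {k h v w : ι → ℝ} {A H δ : ℝ}
    (hA : 0 < A) (hδ : 0 < δ) (hk : Tendsto k l atTop) (hh : ∀ᶠ i in l, |h i| ≤ H)
    (hv : ∀ᶠ i in l, 0 ≤ v i) (hw : ∀ᶠ i in l, 0 ≤ w i)
    (hvw : ∀ᶠ i in l, normBS (k i + h i) (w i) = A * normBS (k i) (v i))
    (hp : ∀ᶠ i in l, normBS (k i) (v i) ≤ 1 - δ)
    (hAp : ∀ᶠ i in l, A * normBS (k i) (v i) ≤ 1 - δ) : v ~[l] w := by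
  refine IsLittleO.of_bound fun c hc => ?_
  have hq : 1 < √(1 + c) := by rw [Real.lt_sqrt zero_le_one]; linarith
  have hq2 : √(1 + c) ^ 2 = 1 + c := Real.sq_sqrt (by linarith)
  have hkh : Tendsto (fun i => k i + h i) l atTop := by
    refine tendsto_atTop_mono' l ?_ (tendsto_atTop_add_const_right l (-H) hk)
    filter_upwards [hh] with i hi
    have := neg_le_of_abs_le hi
    linarith
  have h1 := hk.eventually (eventually_mul_normBS_le (A := A) H hq hδ)
  -- The reverse comparison is the same statement with `A⁻¹` and `-h`.
  have h2 := hkh.eventually (eventually_mul_normBS_le (A := A⁻¹) H hq hδ)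
  filter_upwards [h1, h2, hh, hv, hw, hvw, hp, hAp] with i h1 h2 hh hv hw hvw hp hAp
  have hc1 : 0 ≤ 1 + c := by linarith
  have h3 := (h1 _ hh).2 _ hv hAp
  have h4 := (h2 (-h i) (by rwa [abs_neg])).2 _ hw
  rw [hvw, inv_mul_cancel_left₀ hA.ne', add_neg_cancel_right, hq2] at h4
  rw [← hvw, hq2, (strictMonoOn_normBS _).le_iff_le hw (mul_nonneg hc1 hv)] at h3
  have h5 := ((strictMonoOn_normBS _).le_iff_le hv (mul_nonneg hc1 hw)).1 (h4 hp)
  rw [Pi.sub_apply, Real.norm_eq_abs, Real.norm_eq_abs, abs_of_nonneg hw, abs_sub_le_iff]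
  constructor <;> nlinarith

/-! ### Volatilities of prices of order `exp (-k)`. -/

lemma quantileOne_mul_sqrt {c k : ℝ} (hc : 0 < c) (hk : 0 < k) :
    quantileOne k (c * √k) = -((1 / c - c / 2) * √k) := by
  have hs : √k ^ 2 = k := Real.sq_sqrt hk.le
  have : 0 < √k := Real.sqrt_pos.2 hk
  simp only [quantileOne]
  field_simp
  linear_combination 2 * hs

lemma two_sub_sqrt_two_pos : 0 < 2 - √2 := by
  have : √2 < 2 := by rw [Real.sqrt_lt' two_pos]; norm_num
  linarith

lemma one_div_two_sub_sqrt_two : 1 / (2 - √2) - (2 - √2) / 2 = √2 := by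
  have h := Real.sq_sqrt (zero_le_two (α := ℝ))
  have := two_sub_sqrt_two_pos
  field_simp
  linear_combination h

lemma eventually_normBS_lt {c a : ℝ} (hc : 0 < c) (hc2 : c < 2 - √2) (ha : 0 < a) :
    ∀ᶠ k in atTop, normBS k (c * √k) < a * Real.exp (-k) := by
  set r := 1 / c - c / 2 with hr
  have hr2 : √2 < r := by
    rw [← one_div_two_sub_sqrt_two, hr]
    gcongr
  have hr0 : 0 < r := (Real.sqrt_pos.2 two_pos).trans hr2
  have hβ : 0 < r ^ 2 / 2 - 1 := by
    have := (Real.sqrt_lt' hr0).1 hr2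
    linarith
  have hlim := Real.tendsto_exp_neg_atTop_nhds_zero.comp
    (tendsto_id.const_mul_atTop hβ)
  filter_upwards [eventually_gt_atTop 0, hlim.eventually_lt_const ha] with k hk hka
  have hsk : 0 < √k := Real.sqrt_pos.2 hk
  have hq := quantileOne_mul_sqrt hc hk
  rw [← hr] at hq
  have h1 := normBS_le_exp (mul_pos hc hsk).ne' (by rw [hq, neg_nonpos]; positivity)
  rw [hq, neg_sq, mul_pow, Real.sq_sqrt hk.le] at h1
  refine h1.trans_lt ?_
  have h2 : -(r ^ 2 * k / 2) = -((r ^ 2 / 2 - 1) * k) + -k := by ring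
  rw [h2, Real.exp_add]
  gcongr
  exact hka

/-- Between `(2 - √2) √k` and `c √k` the vega is at least `exp (-k) / √(2π)`, and the length of this
interval, of order `√k`, beats any `a`. The bound `c ≤ √2` keeps the quantile nonpositive, so the
density is smallest at the left end. -/
lemma eventually_lt_normBS {c a : ℝ} (hc : 2 - √2 < c) (hc2 : c ≤ √2) :
    ∀ᶠ k in atTop, a * Real.exp (-k) < normBS k (c * √k) := by
  have hc0 := two_sub_sqrt_two_pos
  have hb : 0 < (√(2 * Real.pi))⁻¹ * (c - (2 - √2)) :=
    mul_pos (by positivity) (sub_pos.2 hc)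
  filter_upwards [eventually_gt_atTop 0,
    (Real.tendsto_sqrt_atTop.const_mul_atTop hb).eventually_gt_atTop a] with k hk hka
  have hsk : 0 < √k := Real.sqrt_pos.2 hk
  have hlt : (2 - √2) * √k < c * √k := by gcongr
  have hpos : 0 < (2 - √2) * √k := by positivity
  obtain ⟨u, hu, hslope⟩ := exists_hasDerivAt_eq_slope (normBS k)
    (fun u => normalPDF (quantileOne k u)) hlt
    ((continuousOn_normBS k).mono fun x hx => hpos.le.trans hx.1)
    (fun x hx => hasDerivAt_normBS k (hpos.trans hx.1).ne')
  rw [eq_div_iff (sub_pos.2 hlt).ne'] at hslope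
  have h1 : -(√2 * √k) ≤ quantileOne k u := by
    have h := quantileOne_mono hk.le hpos hu.1.le
    rwa [quantileOne_mul_sqrt hc0 hk, one_div_two_sub_sqrt_two] at h
  have h2 : quantileOne k u ≤ 0 := by
    have h := quantileOne_mono hk.le (hpos.trans hu.1) hu.2.le
    rw [quantileOne_mul_sqrt (hc0.trans hc) hk] at h
    refine h.trans (neg_nonpos.2 (mul_nonneg ?_ hsk.le))
    have hc' : 0 < c := hc0.trans hc
    have h3 : c ^ 2 ≤ 2 := (Real.le_sqrt' hc').1 hc2
    have h4 : 1 / c - c / 2 = (2 - c ^ 2) / (2 * c) := by field_simp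
    rw [h4]
    exact div_nonneg (by linarith) (by linarith)
  have h3 : quantileOne k u ^ 2 / 2 ≤ k := by
    have h4 : (√2 * √k) ^ 2 = 2 * k := by
      rw [mul_pow, Real.sq_sqrt zero_le_two, Real.sq_sqrt hk.le]
    nlinarith
  have h4 : (√(2 * Real.pi))⁻¹ * Real.exp (-k) ≤ normalPDF (quantileOne k u) := by
    rw [normalPDF]
    gcongr
  calc a * Real.exp (-k)
      < (√(2 * Real.pi))⁻¹ * (c - (2 - √2)) * √k * Real.exp (-k) := by gcongr
    _ = (√(2 * Real.pi))⁻¹ * Real.exp (-k) * (c * √k - (2 - √2) * √k) := by ring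
    _ ≤ normalPDF (quantileOne k u) * (c * √k - (2 - √2) * √k) :=
        mul_le_mul_of_nonneg_right h4 (sub_pos.2 hlt).le
    _ = normBS k (c * √k) - normBS k ((2 - √2) * √k) := hslope
    _ ≤ normBS k (c * √k) := by linarith [normBS_nonneg k hpos.le]

/-- Implied volatilities of prices of the order of `exp (-k)`. -/
lemma isEquivalent_sqrt_of_normBS {ι : Type*} {l : Filter ι} {k v : ι → ℝ} {a b : ℝ}
    (ha : 0 < a) (hk : Tendsto k l atTop) (hv : ∀ᶠ i in l, 0 ≤ v i)
    (h1 : ∀ᶠ i in l, a * Real.exp (-k i) ≤ normBS (k i) (v i))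
    (h2 : ∀ᶠ i in l, normBS (k i) (v i) ≤ b * Real.exp (-k i)) :
    v ~[l] fun i => (2 - √2) * √(k i) := by
  have hc0 := two_sub_sqrt_two_pos
  have hc1 : 2 - √2 < √2 := by
    have : 1 < √2 := by rw [Real.lt_sqrt zero_le_one]; norm_num
    linarith
  have hlow : ∀ c, 0 < c → c < 2 - √2 → ∀ᶠ i in l, c * √(k i) < v i := by
    intro c hc hc'
    filter_upwards [hk.eventually (eventually_normBS_lt hc hc' ha), hv, h1] with i hi hv h1
    exact ((strictMonoOn_normBS _).lt_iff_lt (mul_nonneg hc.le (Real.sqrt_nonneg _)) hv).1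
      (hi.trans_le h1)
  have hupp : ∀ c, 2 - √2 < c → c ≤ √2 → ∀ᶠ i in l, v i < c * √(k i) := by
    intro c hc hc'
    filter_upwards [hk.eventually (eventually_lt_normBS hc hc' (a := b)), hv, h2] with i hi hv h2
    exact ((strictMonoOn_normBS _).lt_iff_lt hv
      (mul_nonneg (hc0.trans hc).le (Real.sqrt_nonneg _))).1 (h2.trans_lt hi)
  refine IsLittleO.of_bound fun ε hε => ?_
  -- The `max` keeps `c` positive when `ε ≥ 1`; the `min` below keeps `c ≤ √2`.
  have h3 := hlow (max ((1 - ε) * (2 - √2)) ((2 - √2) / 2))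
    (lt_max_of_lt_right (half_pos hc0)) (max_lt (by nlinarith) (half_lt_self hc0))
  have h4 := hupp (min ((1 + ε) * (2 - √2)) √2) (lt_min (by nlinarith) hc1) (min_le_right _ _)
  filter_upwards [h3, h4] with i h3 h4
  have hs := Real.sqrt_nonneg (k i)
  rw [Pi.sub_apply, Real.norm_eq_abs, Real.norm_eq_abs, abs_of_nonneg (mul_nonneg hc0.le hs),
    abs_sub_le_iff]
  have h5 := mul_le_mul_of_nonneg_right (le_max_left ((1 - ε) * (2 - √2)) ((2 - √2) / 2)) hs
  have h6 := mul_le_mul_of_nonneg_right (min_le_left ((1 + ε) * (2 - √2)) √2) hs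
  constructor <;> nlinarith

/-! ### Convexity and Taylor remainders. -/

lemma ConvexOn.antitoneOn_Ici_of_bddAbove {g : ℝ → ℝ} {a B : ℝ}
    (hg : ConvexOn ℝ (Set.Ici a) g) (hB : ∀ x, a ≤ x → g x ≤ B) :
    AntitoneOn g (Set.Ici a) := by
  intro x hx y hy hxy
  by_contra! hlt
  have hxy' : x < y := hxy.lt_of_ne fun h => by simp [h] at hlt
  set s := (g y - g x) / (y - x) with hs
  have hs0 : 0 < s := div_pos (sub_pos.2 hlt) (sub_pos.2 hxy')
  -- By convexity a rise of slope `s` persists; one unit beyond where that line reaches `B`, the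
  -- bound fails.
  have hpos : 0 < (B - g y) / s + 1 := by
    have := div_nonneg (sub_nonneg.2 (hB y hy)) hs0.le
    linarith
  have hz : y < y + ((B - g y) / s + 1) := by linarith
  have haz : a ≤ y + ((B - g y) / s + 1) := (show a ≤ y from hy).trans hz.le
  have h1 := hg.slope_mono_adjacent hx haz hxy' hz
  rw [add_sub_cancel_left, ← hs, le_div_iff₀ hpos, mul_add, mul_div_cancel₀ _ hs0.ne'] at h1
  linarith [hB _ haz]

/-- One use of l'Hôpital leaves the difference quotient of `deriv g` at `x`, so continuity of the
second derivative is not needed. -/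
lemma tendsto_second_order_remainder {g : ℝ → ℝ} {x : ℝ}
    (h1 : ∀ᶠ y in 𝓝 x, DifferentiableAt ℝ g y) (h2 : DifferentiableAt ℝ (deriv g) x) :
    Tendsto (fun t => (g (x + t) - g x - deriv g x * t) / t ^ 2) (𝓝[>] 0)
      (𝓝 (deriv (deriv g) x / 2)) := by
  have hshift : Tendsto (fun t : ℝ => x + t) (𝓝 0) (𝓝 x) := by
    simpa using (continuous_const_add x).tendsto 0
  refine HasDerivAt.lhopital_zero_nhdsGT (f' := fun t => deriv g (x + t) - deriv g x)
    (g' := fun t => 2 * t) ?_ ?_ ?_ ?_ ?_ ?_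
  · filter_upwards [nhdsWithin_le_nhds (hshift.eventually h1)] with t ht
    have h3 := (ht.hasDerivAt.comp_const_add x t).sub_const (g x)
    exact (h3.sub ((hasDerivAt_id t).const_mul (deriv g x))).congr_deriv (by rw [mul_one])
  · exact Eventually.of_forall fun t => by simpa using hasDerivAt_pow 2 t
  · filter_upwards [self_mem_nhdsWithin] with t ht
    exact mul_ne_zero two_ne_zero (ne_of_gt ht)
  · have h3 : ContinuousAt (fun t => g (x + t) - g x - deriv g x * t) 0 := by
      refine ContinuousAt.sub (ContinuousAt.sub ?_ continuousAt_const) (by fun_prop)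
      have := h1.self_of_nhds.continuousAt
      exact ContinuousAt.comp (g := g) (by simpa using this) (by fun_prop)
    simpa using h3.tendsto.mono_left (nhdsWithin_le_nhds (s := Set.Ioi 0))
  · have h3 : Continuous fun t : ℝ => t ^ 2 := by fun_prop
    simpa using (h3.tendsto 0).mono_left (nhdsWithin_le_nhds (s := Set.Ioi 0))
  · have h3 := h2.hasDerivAt.tendsto_slope_zero_right.div_const 2
    refine h3.congr fun t => ?_
    rw [smul_eq_mul]
    ring

/-- Put-call parity for the normalised price: the Put at strike `M` per unit of strike. -/
lemma normBS_neg_log_of_blackScholes {X M v : ℝ} (hX : 0 < X) (hM : 0 < M) :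
    normBS (-Real.log (M / X)) v = (blackScholes X M v - X + M) / M := by
  rw [normBS_neg, blackScholes_eq hX hM, Real.exp_neg, Real.exp_log (div_pos hM hX)]
  field_simp
  ring

/-! ### Call pricing functions and their volatilities. -/

namespace IsCallPricing

variable {C : ℝ → ℝ → ℝ} {K S : ℝ}

lemma nonneg (hC : IsCallPricing C) (hS : 0 < S) {L : ℝ} (hL : 0 ≤ L) : 0 ≤ C S L :=
  (le_max_right _ _).trans (hC.intrinsic_le S hS L hL)

lemma antitoneOn (hC : IsCallPricing C) (hS : 0 < S) : AntitoneOn (C S) (Set.Ici 0) :=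
  (hC.convex S hS).antitoneOn_Ici_of_bddAbove (hC.le_underlier S hS)

lemma hasDerivWithinAt_strikeDeriv (hC : IsCallPricing C) (hS : 0 < S) (hK : 0 < K) :
    HasDerivWithinAt (C S) (strikeDeriv C S K) (Set.Ioi K) K :=
  (hC.convex S hS).hasDerivWithinAt_rightDeriv_of_mem_interior (by rwa [interior_Ici])

lemma add_strikeDeriv_mul_le (hC : IsCallPricing C) (hS : 0 < S) (hK : 0 < K) {M : ℝ}
    (hM : 0 < M) : C S K + strikeDeriv C S K * M ≤ C S (K + M) := by
  have h := (hC.convex S hS).le_slope_of_hasDerivWithinAt_Ioi (x := K) (y := K + M)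
    hK.le (by simp only [Set.mem_Ici]; linarith) (by linarith)
    (hC.hasDerivWithinAt_strikeDeriv hS hK)
  rw [slope_def_field, add_sub_cancel_left, le_div_iff₀ hM] at h
  linarith

lemma lt_of_strikeDeriv_neg (hC : IsCallPricing C) (hS : 0 < S) (hK : 0 < K)
    (hslope : strikeDeriv C S K < 0) {M : ℝ} (hM : 0 < M) : C S (K + M) < C S K := by
  have h := (hasDerivWithinAt_iff_tendsto_slope' Set.self_notMem_Ioi).1
    (hC.hasDerivWithinAt_strikeDeriv hS hK)
  obtain ⟨z, hz, hzK⟩ := ((h.eventually_lt_const hslope).and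
    (Ioo_mem_nhdsGT (show K < K + M by linarith))).exists
  rw [slope_def_field, div_lt_iff₀ (sub_pos.2 hzK.1), zero_mul] at hz
  have h1 := hC.antitoneOn hS (hK.le.trans hzK.1.le)
    (show (0 : ℝ) ≤ K + M by linarith) hzK.2.le
  linarith

lemma pos_of_strikeDeriv_neg (hC : IsCallPricing C) (hS : 0 < S) (hK : 0 < K)
    (hslope : strikeDeriv C S K < 0) : 0 < C S K :=
  (hC.nonneg hS (by linarith : (0 : ℝ) ≤ K + 1)).trans_lt
    (hC.lt_of_strikeDeriv_neg hS hK hslope one_pos)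

/-- The volatilities of `C S (K + M)` against `S` and of the same price divided by `m`, against
`C S K / m`, are equivalent for large strikes. -/
lemma isEquivalent_impliedVol_atTop (hC : IsCallPricing C) (hS : 0 < S) (hK : 0 < K)
    (hslope : strikeDeriv C S K < 0) {v w : ℝ → ℝ} {m : ℝ} (hm : 0 < m)
    (hv : ∀ M, 0 < M → 0 ≤ v M ∧ blackScholes S (K + M) (v M) = C S (K + M))
    (hw : ∀ M, 0 < M → 0 ≤ w M ∧ blackScholes (C S K / m) M (w M) = C S (K + M) / m) :
    v ~[atTop] w := by
  have hX := hC.pos_of_strikeDeriv_neg hS hK hslope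
  have hXS := hC.le_underlier S hS K hK.le
  have hXm : 0 < C S K / m := div_pos hX hm
  have h1K := hC.lt_of_strikeDeriv_neg hS hK hslope one_pos
  have hle : ∀ M, 1 ≤ M → C S (K + M) ≤ C S (K + 1) := fun M hM =>
    hC.antitoneOn hS (show (0 : ℝ) ≤ K + 1 by linarith) (show (0 : ℝ) ≤ K + M by linarith)
      (by linarith)
  have hv' : ∀ M, 0 < M → normBS (Real.log ((K + M) / S)) (v M) = C S (K + M) / S := by
    intro M hM
    rw [← (hv M hM).2, blackScholes_eq hS (by linarith)]
    field_simp
  have hw' : ∀ M, 0 < M → normBS (Real.log (M / (C S K / m))) (w M) = C S (K + M) / C S K := by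
    intro M hM
    have h := (hw M hM).2
    rw [blackScholes_eq hXm hM] at h
    field_simp at h ⊢
    linarith
  have hmono : Tendsto (fun M : ℝ => K + M) atTop atTop :=
    tendsto_atTop_add_const_left _ _ tendsto_id
  -- The `log 2` in `H` bounds `log ((K + M) / M)` for `M ≥ K`. The same `δ` serves both prices when
  -- `M ≥ 1`, because `C S K ≤ S`.
  refine isEquivalent_of_normBS (k := fun M => Real.log ((K + M) / S))
    (h := fun M => Real.log (M / (C S K / m)) - Real.log ((K + M) / S))
    (A := S / C S K) (H := |Real.log (S / (C S K / m))| + Real.log 2)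
    (δ := 1 - C S (K + 1) / C S K) (div_pos hS hX) (sub_pos.2 ((div_lt_one hX).2 h1K))
    (Real.tendsto_log_atTop.comp (hmono.atTop_div_const hS)) ?_ ?_ ?_ ?_ ?_ ?_
  · filter_upwards [eventually_ge_atTop K] with M hM
    have hM0 : 0 < M := hK.trans_le hM
    have h1 : Real.log (M / (C S K / m)) - Real.log ((K + M) / S) =
        Real.log (S / (C S K / m)) - Real.log ((K + M) / M) := by
      rw [Real.log_div hM0.ne' hXm.ne', Real.log_div (by positivity) hS.ne',
        Real.log_div hS.ne' hXm.ne', Real.log_div (by positivity) hM0.ne']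
      ring
    have h2 : Real.log ((K + M) / M) ≤ Real.log 2 := by
      refine Real.log_le_log (by positivity) ?_
      rw [div_le_iff₀ hM0]
      linarith
    have h3 : 0 ≤ Real.log ((K + M) / M) := by
      refine Real.log_nonneg ?_
      rw [le_div_iff₀ hM0]
      linarith
    rw [h1]
    refine (abs_sub _ _).trans ?_
    rw [abs_of_nonneg h3]
    linarith
  · filter_upwards [eventually_gt_atTop 0] with M hM using (hv M hM).1
  · filter_upwards [eventually_gt_atTop 0] with M hM using (hw M hM).1
  · filter_upwards [eventually_gt_atTop 0] with M hM
    rw [add_sub_cancel, hw' M hM, hv' M hM]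
    field_simp
  · filter_upwards [eventually_ge_atTop 1] with M hM
    rw [hv' M (by linarith), sub_sub_cancel]
    exact div_le_div₀ (hC.nonneg hS (by linarith)) (hle M hM) hX hXS
  · filter_upwards [eventually_ge_atTop 1] with M hM
    rw [hv' M (by linarith), sub_sub_cancel, div_mul_div_comm, mul_comm S,
      mul_div_mul_right _ _ hS.ne']
    exact div_le_div_of_nonneg_right (hle M hM) hX.le

/-- Small strike asymptotics of the volatility of the price `C S (K + M)` rescaled so that its
slope at `M = 0` is `-1`. -/
lemma isEquivalent_impliedVol_nhdsGT (hC : IsCallPricing C) (hS : 0 < S) (hK : 0 < K)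
    (hslope : strikeDeriv C S K < 0) (hd : ∀ᶠ L in 𝓝 K, DifferentiableAt ℝ (C S) L)
    (hd2 : DifferentiableAt ℝ (deriv (C S)) K) (hpos : 0 < deriv (deriv (C S)) K) {X : ℝ}
    (hX : X = C S K / (-strikeDeriv C S K)) {w : ℝ → ℝ}
    (hw : ∀ M, 0 < M → 0 ≤ w M ∧
      blackScholes X M (w M) = C S (K + M) / (-strikeDeriv C S K)) :
    w ~[𝓝[>] 0] fun M => (2 - √2) * √(-Real.log (M / X)) := by
  have hderiv : strikeDeriv C S K = deriv (C S) K :=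
    hd.self_of_nhds.derivWithin (uniqueDiffWithinAt_Ioi K)
  set m := -strikeDeriv C S K with hm
  set γ := deriv (deriv (C S)) K
  have hm0 : 0 < m := neg_pos.2 hslope
  have hX0 : 0 < X := hX ▸ div_pos (hC.pos_of_strikeDeriv_neg hS hK hslope) hm0
  have hlim := tendsto_second_order_remainder hd hd2
  rw [← hderiv] at hlim
  have hprice : ∀ M, 0 < M → normBS (-Real.log (M / X)) (w M) =
      (C S (K + M) - C S K - strikeDeriv C S K * M) / M ^ 2 * (X / m) *
        Real.exp (- -Real.log (M / X)) := by
    intro M hM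
    rw [normBS_neg_log_of_blackScholes hX0 hM, (hw M hM).2, neg_neg,
      Real.exp_log (div_pos hM hX0), hX, show strikeDeriv C S K = -m by rw [hm, neg_neg]]
    have := hC.pos_of_strikeDeriv_neg hS hK hslope
    field_simp
    ring
  -- `γ / 4` and `γ` bracket the limit `γ / 2` of the Taylor quotient.
  refine isEquivalent_sqrt_of_normBS (k := fun M => -Real.log (M / X)) (a := γ / 4 * (X / m))
    (b := γ * (X / m)) (by positivity) ?_ ?_ ?_ ?_
  · have h1 : Tendsto (fun M : ℝ => M / X) (𝓝[>] 0) (𝓝[>] 0) := by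
      refine tendsto_nhdsWithin_iff.2 ⟨?_, ?_⟩
      · have h : Continuous fun M : ℝ => M / X := by fun_prop
        simpa using (h.tendsto 0).mono_left (nhdsWithin_le_nhds (s := Set.Ioi 0))
      · filter_upwards [self_mem_nhdsWithin] with M hM using div_pos hM hX0
    exact tendsto_neg_atBot_atTop.comp (Real.tendsto_log_nhdsGT_zero.comp h1)
  · filter_upwards [self_mem_nhdsWithin] with M hM using (hw M hM).1
  · filter_upwards [self_mem_nhdsWithin,
      hlim.eventually_const_le (show γ / 4 < γ / 2 by linarith)] with M hM h
    rw [hprice M hM]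
    gcongr
  · filter_upwards [self_mem_nhdsWithin,
      hlim.eventually_le_const (show γ / 2 < γ by linarith)] with M hM h
    rw [hprice M hM]
    gcongr

end IsCallPricing

/-! ### The lifted Call on Call. -/

theorem mainTheorem12 (C : ℝ → ℝ → ℝ) (hC : IsCallPricing C) (K : ℝ) (hK : 0 < K)
    -- `S ↦ C(S, K)` is invertible
    (hinv : Set.InjOn (fun S => C S K) (Set.Ioi 0))
    -- `f` recovers `X` from `X**`
    (f : ℝ → ℝ)
    (hf : ∀ S, 0 < S → strikeDeriv C S K < 0 → f (liftedUnderlier C K S) = C S K)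
    -- `X**` is the lifted underlier of a state `S` with `P(S_T > K) > 0`
    (S : ℝ) (hS : 0 < S) (hslope : strikeDeriv C S K < 0)
    (Xss : ℝ) (hXss : Xss = liftedUnderlier C K S) :
    -- the implied total volatilities are well defined
    (∀ M, 0 < M →
      (∃! v, 0 ≤ v ∧ blackScholes Xss M v = liftedCallOnCall C f K Xss M) ∧
      (∃! v, 0 ≤ v ∧ blackScholes (invPrice C (f Xss) K) (K + M) v
        = C (invPrice C (f Xss) K) (K + M))) ∧
    -- slope `-1` at zero strike
    HasDerivWithinAt (fun M => liftedCallOnCall C f K Xss M) (-1) (Set.Ici 0) 0 ∧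
    -- small strikes
    ((∀ᶠ L in 𝓝 K, DifferentiableAt ℝ (C S) L) → DifferentiableAt ℝ (deriv (C S)) K →
      0 < deriv (deriv (C S)) K →
      (fun M => liftedVol C f K Xss M) ~[𝓝[>] 0]
        (fun M => (2 - √2) * √(-Real.log (M / Xss)))) ∧
    -- large strikes
    (fun M => liftedVol C f K Xss M) ~[atTop]
      (fun M => underlyingVol C (invPrice C (f Xss) K) (K + M)) ∧
    -- limits at infinity, finite or infinite
    (∀ l : ℝ, Tendsto (fun M => liftedVol C f K Xss M) atTop (𝓝 l) ↔
      Tendsto (fun M => underlyingVol C (invPrice C (f Xss) K) (K + M)) atTop (𝓝 l)) ∧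
    (Tendsto (fun M => liftedVol C f K Xss M) atTop atTop ↔
      Tendsto (fun M => underlyingVol C (invPrice C (f Xss) K) (K + M)) atTop atTop) := by
  have hX := hC.pos_of_strikeDeriv_neg hS hK hslope
  have hm : 0 < -strikeDeriv C S K := neg_pos.2 hslope
  have hfX : f Xss = C S K := by rw [hXss, hf S hS hslope]
  have hinvS : invPrice C (f Xss) K = S := by
    rw [hfX]
    exact hinv.leftInvOn_invFunOn hS
  have hXss' : Xss = C S K / (-strikeDeriv C S K) := hXss
  have hXss0 : 0 < Xss := hXss' ▸ div_pos hX hm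
  have hlift : ∀ M, liftedCallOnCall C f K Xss M = C S (K + M) / (-strikeDeriv C S K) := by
    intro M
    rw [liftedCallOnCall, callOnCall, hinvS, hfX, hXss']
    field_simp
  -- The tangent line at `K`, divided by `m`, is exactly `X** - M`: the lift makes the intrinsic
  -- bound hold.
  have hlower : ∀ M, 0 < M → Xss - M ≤ C S (K + M) / (-strikeDeriv C S K) := by
    intro M hM
    rw [le_div_iff₀ hm, hXss', sub_mul, div_mul_cancel₀ _ hm.ne']
    linarith [hC.add_strikeDeriv_mul_le hS hK hM]
  have hex1 : ∀ M, 0 < M → ∃! v, 0 ≤ v ∧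
      blackScholes Xss M v = liftedCallOnCall C f K Xss M := by
    intro M hM
    rw [hlift]
    refine existsUnique_blackScholes_eq hXss0 hM
      (div_nonneg (hC.nonneg hS (by linarith)) hm.le) (hlower M hM) ?_
    rw [hXss']
    exact div_lt_div_of_pos_right (hC.lt_of_strikeDeriv_neg hS hK hslope hM) hm
  have hex2 : ∀ M, 0 < M → ∃! v, 0 ≤ v ∧
      blackScholes (invPrice C (f Xss) K) (K + M) v = C (invPrice C (f Xss) K) (K + M) := by
    intro M hM
    have hKM : 0 ≤ K + M := by linarith
    rw [hinvS]
    exact existsUnique_blackScholes_eq hS (by linarith) (hC.nonneg hS hKM)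
      ((le_max_left _ _).trans (hC.intrinsic_le S hS _ hKM))
      ((hC.lt_of_strikeDeriv_neg hS hK hslope hM).trans_le (hC.le_underlier S hS K hK.le))
  have hw : ∀ M, 0 < M → 0 ≤ liftedVol C f K Xss M ∧
      blackScholes Xss M (liftedVol C f K Xss M) = C S (K + M) / (-strikeDeriv C S K) :=
    fun M hM => hlift M ▸ impliedVol_spec (hex1 M hM)
  have hv : ∀ M, 0 < M → 0 ≤ underlyingVol C (invPrice C (f Xss) K) (K + M) ∧
      blackScholes S (K + M) (underlyingVol C (invPrice C (f Xss) K) (K + M)) = C S (K + M) := by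
    intro M hM
    have h := impliedVol_spec (hex2 M hM)
    rw [hinvS] at h ⊢
    exact h
  have hequiv : (fun M => liftedVol C f K Xss M) ~[atTop]
      (fun M => underlyingVol C (invPrice C (f Xss) K) (K + M)) :=
    (hC.isEquivalent_impliedVol_atTop hS hK hslope hm hv fun M hM => hXss' ▸ hw M hM).symm
  refine ⟨fun M hM => ⟨hex1 M hM, hex2 M hM⟩, ?_, fun hd hd2 hpos =>
    hC.isEquivalent_impliedVol_nhdsGT hS hK hslope hd hd2 hpos hXss' hw, hequiv,
    fun l => hequiv.tendsto_nhds_iff, hequiv.tendsto_atTop_iff⟩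
  simp_rw [hlift]
  have h1 := ((hC.hasDerivWithinAt_strikeDeriv hS hK).Ici_of_Ioi.comp_of_eq 0
    (((hasDerivAt_id (0 : ℝ)).const_add K).hasDerivWithinAt (s := Set.Ici 0))
    (fun M hM => by simpa using hM) (by simp)).div_const (-strikeDeriv C S K)
  refine h1.congr_deriv ?_
  rw [mul_one, div_neg, div_self hslope.ne]
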